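/- Let $\eta=\mathrm{diag}(-1,1,1)$ be the Minkowski metric on $\mathbb R^{1+2}$ with rectilinear coordinates $(t=x^0,x^1,x^2)$, put $x_\mu=\eta_{\mu\lambda}x^\lambda$, and let $Z_{\mu\nu}=x_\mu\partial_\nu-x_\nu\partial_\mu$ $(\mu,\nu\in\{0,1,2\})$ be the Lorentz and rotation vector fields. For $\tau>0$ let $\mathcal H_\tau=\{x:\ -(x^0)^2+(x^1)^2+(x^2)^2=-\tau^2,\ x^0>0\}$, to which the fields $Z_{\mu\nu}$ are tangent, let $d\sigma$ be the volume measure of the metric induced on $\mathcal H_\tau$, and let $y\ge 0$ be the hyperboloidal coordinate, $t=\tau\cosh y$, $\sqrt{(x^1)^2+(x^2)^2}=\tau\sinh y$. Let $\mathfrak G$ be a (finite-dimensional, real) Lie group with Lie algebra $\mathfrak g$, let $V$ be a finite-dimensional complex inner product space, and let $\rho:\mathfrak G\to U(V)$ be a smooth unitary representation, so that $a\in\mathfrak g$ acts on $V$ by $a\cdot v=(d\rho|_1 a)v$. For a $\mathfrak g$-valued connection 1-form $A$ on Minkowski space, smooth along $\mathcal H_\tau$, and a smooth function $\phi:\mathcal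 H_\tau\to V$, put $\mathbf Z_{\mu\nu}\phi=Z_{\mu\nu}\phi+A(Z_{\mu\nu})\cdot\phi$. Let $\|\cosh y\,\mathbf Z^{(k)}\phi\|_{L^2(\mathcal H_\tau,\,d\sigma/\cosh y)}$ denote the sum of the norms $\|\cosh y\,\mathbf Z_{\mu_1\nu_1}\cdots\mathbf Z_{\mu_k\nu_k}\phi\|_{L^2(\mathcal H_\tau,\,d\sigma/\cosh y)}$ over all choices of the indices $\mu_i,\nu_i\in\{0,1,2\}$. Then there is a constant $C>0$, independent of $\tau$, $\mathfrak G$, $V$, $\rho$, $A$ and $\phi$, such that for all such data $$\tau\,\|\cosh y\,\phi\|_{L^\infty(\mathcal H_\tau,\,d\sigma/\cosh y)}\ \le\ C\sum_{0\le k\le 2}\|\cosh y\,\mathbf Z^{(k)}\phi\|_{L^2(\mathcal H_\tau,\,d\sigma/\cosh y)},$$ as an inequality in $[0,\infty]$ (it is trivial when the right-hand side is infinite). -/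

import Mathlib

open MeasureTheory
open scoped ContDiff Manifold ENNReal

noncomputable section

namespace GaugeHyp

/-! ### Minkowski space, its Lorentz fields, and the hyperboloids -/

/-- `ℝ^{1+2}` in rectilinear coordinates `(x⁰ = t, x¹, x²)`. -/
abbrev Spacetime : Type := Fin 3 → ℝ

/-- The Minkowski metric of signature `(-,+,+)`. -/
def eta (X Y : Spacetime) : ℝ := -(X 0 * Y 0) + X 1 * Y 1 + X 2 * Y 2

/-- The lowered coordinates `x_μ = η_{μλ} x^λ`. -/
def lower (x : Spacetime) (μ : Fin 3) : ℝ := eta (Pi.single μ 1) x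

/-- The vector field `Z_{μν} = x_μ ∂_ν - x_ν ∂_μ` (a Lorentz boost or the rotation). -/
def lorentzField (μ ν : Fin 3) (x : Spacetime) : Spacetime :=
  lower x μ • (Pi.single ν (1 : ℝ) : Spacetime) - lower x ν • (Pi.single μ (1 : ℝ) : Spacetime)

/-- The hyperboloid `H_τ = {-(x⁰)² + (x¹)² + (x²)² = -τ², x⁰ > 0}`. -/
def Hyp (τ : ℝ) : Set Spacetime := {x | eta x x = -τ ^ 2 ∧ 0 < x 0}

/-- The spatial components `(X¹, X²)` of `X`. -/
def spatial : Spacetime →L[ℝ] (Fin 2 → ℝ) :=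
  ContinuousLinearMap.pi fun j => ContinuousLinearMap.proj j.succ

/-- `H_τ` as a graph over the spatial plane: `x ↦ (√(τ² + |x|²), x)`. -/
def graphPt (τ : ℝ) (x : Fin 2 → ℝ) : Spacetime :=
  ![√(τ ^ 2 + x 0 ^ 2 + x 1 ^ 2), x 0, x 1]

theorem graphPt_mem {τ : ℝ} (hτ : 0 < τ) (x : Fin 2 → ℝ) : graphPt τ x ∈ Hyp τ := by
  have h : 0 < τ ^ 2 + x 0 ^ 2 + x 1 ^ 2 := by positivity
  have h2 := Real.mul_self_sqrt h.le
  refine ⟨?_, by simpa [graphPt] using Real.sqrt_pos.2 h⟩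
  simp only [eta, graphPt, Matrix.cons_val]
  linarith

theorem graphPt_spatial {τ : ℝ} {p : Spacetime} (hp : p ∈ Hyp τ) :
    graphPt τ (spatial p) = p := by
  obtain ⟨h1, h2⟩ := hp
  have h3 : τ ^ 2 + p 1 ^ 2 + p 2 ^ 2 = p 0 ^ 2 := by simp only [eta] at h1; linarith
  ext i
  fin_cases i
  · change √(τ ^ 2 + p 1 ^ 2 + p 2 ^ 2) = p 0
    rw [h3, Real.sqrt_sq h2.le]
  · rfl
  · rfl

theorem continuous_graphPt (τ : ℝ) : Continuous (graphPt τ) := by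
  refine continuous_pi fun i => ?_
  fin_cases i
  · change Continuous fun x : Fin 2 → ℝ => √(τ ^ 2 + x 0 ^ 2 + x 1 ^ 2)
    fun_prop
  · exact continuous_apply 0
  · exact continuous_apply 1

/-- The global chart `(x¹, x²)` of `H_τ`, defining its smooth structure as an embedded
surface. -/
def chart {τ : ℝ} (hτ : 0 < τ) : Hyp τ ≃ₜ (Fin 2 → ℝ) where
  toFun p := spatial p.1
  invFun x := ⟨graphPt τ x, graphPt_mem hτ x⟩
  left_inv p := Subtype.ext (graphPt_spatial p.2)
  right_inv x := by
    ext i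
    fin_cases i <;> rfl
  continuous_toFun := spatial.continuous.comp continuous_subtype_val
  continuous_invFun := (continuous_graphPt τ).subtype_mk _

/-- Smoothness of a function on `H_τ`, read in the global chart. -/
def IsSmooth {τ : ℝ} (hτ : 0 < τ) {F : Type*} [NormedAddCommGroup F] [NormedSpace ℝ F]
    (f : Hyp τ → F) : Prop :=
  ContDiff ℝ ∞ (f ∘ (chart hτ).symm)

/-- The derivative at `p ∈ H_τ` of a function on `H_τ` in the direction of a vector `X` tangent
to `H_τ`: in the chart `(x¹, x²)` the vector `X` has components `(X¹, X²)`. -/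
def tangentDeriv {τ : ℝ} (hτ : 0 < τ) {F : Type*} [NormedAddCommGroup F] [NormedSpace ℝ F]
    (f : Hyp τ → F) (p : Hyp τ) (X : Spacetime) : F :=
  fderiv ℝ (f ∘ (chart hτ).symm) (chart hτ p) (spatial X)

/-- The fields `Z_{μν}` are tangent to the hyperboloids. -/
theorem eta_lorentzField (μ ν : Fin 3) (x : Spacetime) : eta x (lorentzField μ ν x) = 0 := by
  fin_cases μ <;> fin_cases ν <;> simp [eta, lorentzField, lower] <;> ring

/-- The differential of the graph parametrization. -/
theorem hasFDerivAt_graphPt {τ : ℝ} (hτ : 0 < τ) (x v : Fin 2 → ℝ) :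
    DifferentiableAt ℝ (graphPt τ) x ∧ fderiv ℝ (graphPt τ) x v =
      ![(x 0 * v 0 + x 1 * v 1) / √(τ ^ 2 + x 0 ^ 2 + x 1 ^ 2), v 0, v 1] := by
  have h : 0 < τ ^ 2 + x 0 ^ 2 + x 1 ^ 2 := by positivity
  have hp (i : Fin 2) : HasFDerivAt (fun y : Fin 2 → ℝ => y i)
      (ContinuousLinearMap.proj i : (Fin 2 → ℝ) →L[ℝ] ℝ) x := hasFDerivAt_apply i x
  have h0 := ((((hp 0).pow 2).const_add (τ ^ 2)).add ((hp 1).pow 2)).sqrt h.ne'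
  let L := (1 / (2 * √(τ ^ 2 + x 0 ^ 2 + x 1 ^ 2))) •
    ((2 * x 0) • (ContinuousLinearMap.proj 0 : (Fin 2 → ℝ) →L[ℝ] ℝ) +
      (2 * x 1) • (ContinuousLinearMap.proj 1 : (Fin 2 → ℝ) →L[ℝ] ℝ))
  have H : HasFDerivAt (graphPt τ) (ContinuousLinearMap.pi (![L, ContinuousLinearMap.proj 0,
      ContinuousLinearMap.proj 1] : Fin 3 → ((Fin 2 → ℝ) →L[ℝ] ℝ))) x := by
    refine hasFDerivAt_pi.2 fun i => ?_
    fin_cases i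
    · refine h0.congr_fderiv ?_
      ext v
      simp [L]
    · exact hp 0
    · exact hp 1
  refine ⟨H.differentiableAt, ?_⟩
  rw [H.fderiv]
  ext i
  fin_cases i
  · simp [L]
    field_simp
  · rfl
  · rfl

/-- A vector tangent to `H_τ` at `p` is the image of its spatial components under the
differential of the parametrization, so `tangentDeriv` is the derivative along it. -/
theorem fderiv_graphPt_spatial {τ : ℝ} (hτ : 0 < τ) (p : Hyp τ) (X : Spacetime)
    (hX : eta p X = 0) : fderiv ℝ (graphPt τ) (chart hτ p) (spatial X) = X := by
  have h0 : √(τ ^ 2 + (chart hτ p) 0 ^ 2 + (chart hτ p) 1 ^ 2) = p.1 0 :=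
    congrFun (graphPt_spatial p.2) 0
  have hp : p.1 0 ≠ 0 := p.2.2.ne'
  have hX' : p.1 1 * X 1 + p.1 2 * X 2 = X 0 * p.1 0 := by simp only [eta] at hX; linarith
  rw [(hasFDerivAt_graphPt hτ _ _).2, h0]
  ext i
  fin_cases i
  · change (p.1 1 * X 1 + p.1 2 * X 2) / p.1 0 = X 0
    rw [hX', mul_div_cancel_right₀ _ hp]
  · rfl
  · rfl

/-- The hyperboloidal coordinate `y ≥ 0`, with `t = τ cosh y` and `r = τ sinh y`. -/
def hypY (τ : ℝ) (p : Spacetime) : ℝ := Real.arsinh (√(p 1 ^ 2 + p 2 ^ 2) / τ)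

theorem hypY_spec {τ : ℝ} (hτ : 0 < τ) {p : Spacetime} (hp : p ∈ Hyp τ) :
    0 ≤ hypY τ p ∧ p 0 = τ * Real.cosh (hypY τ p) ∧
      √(p 1 ^ 2 + p 2 ^ 2) = τ * Real.sinh (hypY τ p) := by
  obtain ⟨h1, h2⟩ := hp
  simp only [eta] at h1
  refine ⟨Real.arsinh_nonneg_iff.2 (by positivity), ?_, ?_⟩
  · rw [hypY, Real.cosh_arsinh, div_pow, Real.sq_sqrt (by positivity)]
    rw [show 1 + (p 1 ^ 2 + p 2 ^ 2) / τ ^ 2 = (p 0 / τ) ^ 2 by field_simp; linarith,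
      Real.sqrt_sq (by positivity)]
    field_simp
  · rw [hypY, Real.sinh_arsinh]
    field_simp

/-- The Gram matrix, in the chart `(x¹, x²)`, of the metric induced on `H_τ` by the Minkowski
metric. -/
def inducedMetric (τ : ℝ) (x : Fin 2 → ℝ) : Matrix (Fin 2) (Fin 2) ℝ :=
  Matrix.of fun i j => eta (fderiv ℝ (graphPt τ) x (Pi.single i 1))
    (fderiv ℝ (graphPt τ) x (Pi.single j 1))

/-- The induced volume measure `dσ = √(det g) dx¹ dx²` on `H_τ`. -/
def hypVol {τ : ℝ} (hτ : 0 < τ) : Measure (Hyp τ) :=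
  ((volume : Measure (Fin 2 → ℝ)).withDensity
    fun x => ENNReal.ofReal √(inducedMetric τ x).det).map (chart hτ).symm

/-- The weighted measure `dσ / cosh y` on `H_τ`. -/
def hypWeighted {τ : ℝ} (hτ : 0 < τ) : Measure (Hyp τ) :=
  (hypVol hτ).withDensity fun p => ENNReal.ofReal (1 / Real.cosh (hypY τ p))

/-! ### Gauge covariant derivatives -/

section Gauge

variable {E : Type*} [NormedAddCommGroup E] [NormedSpace ℝ E]
  {G : Type*} [TopologicalSpace G] [ChartedSpace E G] [Group G]
  {V : Type*} [NormedAddCommGroup V] [InnerProductSpace ℂ V]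

/-- A representation by unitary operators, viewed as a map into the space of operators. -/
def repOp (ρ : G →* (V ≃ₗᵢ[ℂ] V)) (g : G) : V →L[ℂ] V :=
  ((ρ g).toContinuousLinearEquiv : V →L[ℂ] V)

variable (E) in
/-- The infinitesimal action `a · v = (dρ|₁ a) v` of the Lie algebra. -/
def lieAct (ρ : G →* (V ≃ₗᵢ[ℂ] V)) (a : GroupLieAlgebra 𝓘(ℝ, E) G) : V →L[ℂ] V :=
  mfderiv 𝓘(ℝ, E) 𝓘(ℝ, V →L[ℂ] V) (repOp ρ) 1 a

variable {τ : ℝ} (hτ : 0 < τ) (ρ : G →* (V ≃ₗᵢ[ℂ] V))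
  (A : Hyp τ → Spacetime →ₗ[ℝ] GroupLieAlgebra 𝓘(ℝ, E) G)

/-- Smoothness along `H_τ` of a one-form with values in the Lie algebra `T₁G` (which has `E` as
underlying vector space): its components `A_μ = A(∂_μ)` are smooth. -/
def IsSmoothForm : Prop :=
  ∀ μ : Fin 3, IsSmooth hτ (F := E) fun p => A p (Pi.single μ (1 : ℝ))

/-- The gauge covariant derivative `D_X φ = ∂_X φ + A(X) · φ` along a vector `X` tangent to
`H_τ` at `p`. -/
def covD (φ : Hyp τ → V) (p : Hyp τ) (X : Spacetime) : V :=
  tangentDeriv hτ φ p X + lieAct E ρ (A p X) (φ p)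

/-- The operator `𝐙_{μν} = D_{Z_{μν}}`. -/
def covZ (i : Fin 3 × Fin 3) (φ : Hyp τ → V) : Hyp τ → V :=
  fun p => covD hτ ρ A φ p (lorentzField i.1 i.2 p)

/-- The composition of the operators `𝐙_{μν}` indexed by a list. -/
def covZs : List (Fin 3 × Fin 3) → (Hyp τ → V) → Hyp τ → V
  | [], φ => φ
  | i :: l, φ => covZ hτ ρ A i (covZs l φ)

/-- `‖cosh y 𝐙^{(k)} φ‖` in `L²(H_τ, dσ / cosh y)`: the sum over all `k`-fold compositions of
the operators `𝐙_{μν}`. -/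
def normZ (k : ℕ) (φ : Hyp τ → V) : ℝ≥0∞ :=
  ∑ I : Fin k → Fin 3 × Fin 3,
    eLpNorm (fun p : Hyp τ => Real.cosh (hypY τ p) • covZs hτ ρ A (List.ofFn I) φ p) 2
      (hypWeighted hτ)

end Gauge

end GaugeHyp

end

/-! In the chart `(x¹, x²)` one has `τ cosh y = t` and `dσ = (τ/t) dx`, so the weighted norm of
`cosh y · ψ` is the flat `L²(dx)` norm of `ψ` (`eLpNorm_cosh_smul_sq`). The claim becomes `t(a)²
|φ(a)|² ≤ C ∫ (|φ|² + |𝐙φ|² + |𝐙𝐙φ|²) dx` for each point `a`.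

A Sobolev inequality for `φ` itself would bring in `A`, which is not controlled. It is applied
instead to the gauge invariant scalar `|φ|²`: a unitary representation has skew-adjoint differential
(`inner_lieAct_add`), so `A` cancels in the product rule (`fderiv_inner_eq_covZ`). Since `Z_{0j} =
-t ∂_j`, derivatives of `|φ|²` are inner products of covariant boosts of `φ` divided by powers of
`t`.

The `L¹` Sobolev inequality at a corner (`enorm_corner_le_lintegral`) is used on a square of side
`t(a)/4`. There `t ≥ t(a)/2`, so each factor of the side length is absorbed by a factor `1/t`
(`sobolev_integrand_le`). Only `φ`, `𝐙₀₁φ`, `𝐙₀₂φ` and `𝐙₀₁𝐙₀₂φ` occur; the rotation is not needed.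
-/

noncomputable section

namespace GaugeHyp

/-! ### Sobolev inequalities on intervals and squares -/

/-- One-dimensional Sobolev inequality at the left endpoint of an interval. -/
theorem enorm_left_le_lintegral {F : Type*} [NormedAddCommGroup F]
    [NormedSpace ℝ F] [CompleteSpace F] {f f' : ℝ → F} (hf : ∀ x, HasDerivAt f (f' x) x)
    (hf' : Continuous f') (a h : ℝ) :
    ENNReal.ofReal h * ‖f a‖ₑ ≤
      ∫⁻ s in Set.Ioc a (a + h), (‖f s‖ₑ + ENNReal.ofReal h * ‖f' s‖ₑ) := by
  have hc : Continuous f := continuous_iff_continuousAt.2 fun x => (hf x).continuousAt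
  have hm : Measurable fun s => ‖f s‖ₑ := hc.enorm.measurable
  have hm' : Measurable fun s => ‖f' s‖ₑ := hf'.enorm.measurable
  have key : ∀ s ∈ Set.Ioc a (a + h),
      ‖f a‖ₑ ≤ ‖f s‖ₑ + ∫⁻ r in Set.Ioc a (a + h), ‖f' r‖ₑ := by
    intro s hs
    have h1 : f a = f s - ∫ r in a..s, f' r := by
      rw [intervalIntegral.integral_eq_sub_of_hasDerivAt (fun x _ => hf x)
        (hf'.intervalIntegrable _ _)]
      abel
    rw [h1]
    refine (enorm_sub_le).trans (add_le_add le_rfl ?_)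
    rw [intervalIntegral.integral_of_le hs.1.le]
    exact (enorm_integral_le_lintegral_enorm _).trans
      (lintegral_mono_set (Set.Ioc_subset_Ioc_right hs.2))
  have hv : volume (Set.Ioc a (a + h)) = ENNReal.ofReal h := by
    rw [Real.volume_Ioc, add_sub_cancel_left]
  calc ENNReal.ofReal h * ‖f a‖ₑ = ∫⁻ _ in Set.Ioc a (a + h), ‖f a‖ₑ := by
        rw [setLIntegral_const, hv, mul_comm]
    _ ≤ ∫⁻ s in Set.Ioc a (a + h), (‖f s‖ₑ + ∫⁻ r in Set.Ioc a (a + h), ‖f' r‖ₑ) :=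
        setLIntegral_mono (hm.add_const _) key
    _ = _ := by
        rw [lintegral_add_left hm, lintegral_add_left hm,
          setLIntegral_const, hv, lintegral_const_mul _ hm', mul_comm]

/-- Two-dimensional Sobolev inequality at a corner of a square. -/
theorem enorm_corner_le_lintegral {F : Type*} [NormedAddCommGroup F]
    [NormedSpace ℝ F] [CompleteSpace F] {u u₁ u₂ u₁₂ : ℝ × ℝ → F}
    (hu₁ : ∀ x y, HasDerivAt (fun x => u (x, y)) (u₁ (x, y)) x)
    (hu₂ : ∀ x y, HasDerivAt (fun y => u (x, y)) (u₂ (x, y)) y)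
    (hu₁₂ : ∀ x y, HasDerivAt (fun x => u₂ (x, y)) (u₁₂ (x, y)) x)
    (hc : Continuous u) (hc₁ : Continuous u₁) (hc₂ : Continuous u₂) (hc₁₂ : Continuous u₁₂)
    (a : ℝ × ℝ) (h : ℝ) :
    ENNReal.ofReal h ^ 2 * ‖u a‖ₑ ≤
      ∫⁻ p in Set.Ioc a.1 (a.1 + h) ×ˢ Set.Ioc a.2 (a.2 + h),
        (‖u p‖ₑ + ENNReal.ofReal h * ‖u₁ p‖ₑ + ENNReal.ofReal h * ‖u₂ p‖ₑ +
          ENNReal.ofReal h ^ 2 * ‖u₁₂ p‖ₑ) := by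
  set H := ENNReal.ofReal h
  obtain ⟨a, b⟩ := a
  have hH : H ≠ ⊤ := ENNReal.ofReal_ne_top
  have hHc : Continuous fun p : ℝ × ℝ => ‖u p‖ₑ + H * ‖u₁ p‖ₑ + H * ‖u₂ p‖ₑ +
      H ^ 2 * ‖u₁₂ p‖ₑ := by
    have (v : ℝ × ℝ → F) (hv : Continuous v) {K : ℝ≥0∞} (hK : K ≠ ⊤) :
        Continuous fun p => K * ‖v p‖ₑ := (ENNReal.continuous_const_mul hK).comp hv.enorm
    exact ((hc.enorm.add (this _ hc₁ hH)).add (this _ hc₂ hH)).add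
      (this _ hc₁₂ (ENNReal.pow_ne_top hH))
  rw [Measure.volume_eq_prod, ← Measure.prod_restrict,
    lintegral_prod_symm' _ hHc.measurable]
  calc H ^ 2 * ‖u (a, b)‖ₑ = H * (H * ‖u (a, b)‖ₑ) := by ring
    _ ≤ H * ∫⁻ y in Set.Ioc b (b + h), (‖u (a, y)‖ₑ + H * ‖u₂ (a, y)‖ₑ) := by
        gcongr
        exact enorm_left_le_lintegral (fun y => hu₂ a y) (by fun_prop) b h
    _ = ∫⁻ y in Set.Ioc b (b + h), (H * ‖u (a, y)‖ₑ + H * (H * ‖u₂ (a, y)‖ₑ)) := by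
        rw [← lintegral_const_mul _ (by fun_prop)]
        simp only [mul_add]
    _ ≤ _ := by
        refine lintegral_mono fun y => ?_
        -- The interval estimate is now used in `x`, for both `u` and `u₂`; hence the only second
        -- derivative that appears is the mixed one.
        refine (add_le_add (enorm_left_le_lintegral (fun x => hu₁ x y) (by fun_prop) a h)
          (mul_le_mul_right (enorm_left_le_lintegral (fun x => hu₁₂ x y) (by fun_prop) a h)
            H)).trans_eq ?_
        rw [← lintegral_const_mul _ (by fun_prop), ← lintegral_add_left (by fun_prop)]
        refine lintegral_congr fun x => ?_
        ring

/-! ### The measure in the chart -/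

/-- The time coordinate of `H_τ` as a function of the spatial coordinates. -/
def timeFn (τ : ℝ) (x : Fin 2 → ℝ) : ℝ := √(τ ^ 2 + x 0 ^ 2 + x 1 ^ 2)

theorem timeFn_sq (τ : ℝ) (x : Fin 2 → ℝ) : timeFn τ x ^ 2 = τ ^ 2 + x 0 ^ 2 + x 1 ^ 2 :=
  Real.sq_sqrt (by positivity)

theorem timeFn_pos {τ : ℝ} (hτ : 0 < τ) (x : Fin 2 → ℝ) : 0 < timeFn τ x :=
  Real.sqrt_pos.2 (by positivity)

theorem contDiff_timeFn {τ : ℝ} (hτ : 0 < τ) : ContDiff ℝ ∞ (timeFn τ) := by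
  refine ContDiff.sqrt (by fun_prop) fun x => ?_
  positivity

/-- Used to bound `∂₁t = x¹/t` by one in the mixed derivative. -/
theorem abs_le_timeFn (τ : ℝ) (x : Fin 2 → ℝ) : |x 0| ≤ timeFn τ x := by
  refine Real.abs_le_sqrt ?_
  nlinarith [sq_nonneg τ, sq_nonneg (x 1)]

/-- On a square of side `T(a) / 4` with corner `a`, the time function is at least `T(a) / 2`. -/
theorem timeFn_half_le {τ : ℝ} (hτ : 0 < τ) {a x : Fin 2 → ℝ}
    (hx : ∀ i, |x i - a i| ≤ timeFn τ a / 4) : timeFn τ a / 2 ≤ timeFn τ x := by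
  have ha := timeFn_pos hτ a
  have h0 := sq_le_sq' (abs_le.1 (hx 0)).1 (abs_le.1 (hx 0)).2
  have h1 := sq_le_sq' (abs_le.1 (hx 1)).1 (abs_le.1 (hx 1)).2
  refine Real.le_sqrt_of_sq_le ?_
  have := timeFn_sq τ a
  -- The squares give `xᵢ² ≥ aᵢ²/2 - (xᵢ - aᵢ)²`, whence `t(x)² ≥ (1/2 - 1/8) t(a)²`.
  nlinarith [sq_nonneg (2 * x 0 - a 0), sq_nonneg (2 * x 1 - a 1)]

theorem time_chart_symm {τ : ℝ} (hτ : 0 < τ) (x : Fin 2 → ℝ) :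
    ((chart hτ).symm x).1 0 = timeFn τ x := rfl

theorem cosh_hypY {τ : ℝ} (hτ : 0 < τ) (x : Fin 2 → ℝ) :
    Real.cosh (hypY τ ((chart hτ).symm x)) = timeFn τ x / τ := by
  have := (hypY_spec hτ ((chart hτ).symm x).2).2.1
  rw [time_chart_symm] at this
  rw [this]
  field_simp

/-- The metric is the rank-one perturbation `δᵢⱼ - xᵢxⱼ/t²`, with determinant `1 - |x|²/t²`. -/
theorem det_inducedMetric {τ : ℝ} (hτ : 0 < τ) (x : Fin 2 → ℝ) :
    (inducedMetric τ x).det = (τ / timeFn τ x) ^ 2 := by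
  have hT := timeFn_pos hτ x
  have h2 := timeFn_sq τ x
  rw [Matrix.det_fin_two]
  simp only [inducedMetric, Matrix.of_apply, (hasFDerivAt_graphPt hτ _ _).2, eta]
  simp only [show √(τ ^ 2 + x 0 ^ 2 + x 1 ^ 2) = timeFn τ x from rfl]
  simp
  field_simp
  rw [h2]
  ring

/-- In the chart, the weighted measure is `(τ / t)² dx¹ dx²`. -/
theorem lintegral_hypWeighted {τ : ℝ} (hτ : 0 < τ) {F : Hyp τ → ℝ≥0∞} (hF : Measurable F) :
    ∫⁻ p, F p ∂hypWeighted hτ =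
      ∫⁻ x, ENNReal.ofReal ((τ / timeFn τ x) ^ 2) * F ((chart hτ).symm x) := by
  have hT := (contDiff_timeFn hτ).continuous.measurable
  have hY : Measurable fun p : Hyp τ => ENNReal.ofReal (1 / Real.cosh (hypY τ p)) := by
    have : Measurable (hypY τ) := by
      unfold hypY
      exact Real.continuous_arsinh.measurable.comp (by fun_prop)
    exact ENNReal.measurable_ofReal.comp (measurable_const.div
      (Real.measurable_cosh.comp (this.comp measurable_subtype_coe)))
  have hg : Measurable fun x => ENNReal.ofReal √(inducedMetric τ x).det := by
    simp only [det_inducedMetric hτ]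
    fun_prop
  have hs : Measurable (chart hτ).symm := (chart hτ).symm.continuous.measurable
  rw [hypWeighted, lintegral_withDensity_eq_lintegral_mul _ hY hF, hypVol,
    lintegral_map (hY.mul hF) hs]
  refine (lintegral_withDensity_eq_lintegral_mul _ hg ((hY.mul hF).comp hs)).trans ?_
  refine lintegral_congr fun x => ?_
  have hx := timeFn_pos hτ x
  simp only [Pi.mul_apply, Function.comp_apply, det_inducedMetric hτ, cosh_hypY]
  rw [Real.sqrt_sq (by positivity), ← mul_assoc, ← ENNReal.ofReal_mul (by positivity)]
  -- One factor `τ/t` is the volume density, the other is `1/cosh y`.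
  congr 2
  field_simp

/-- The weighted norm `‖cosh y ψ‖` is the flat `L²` norm in the chart. -/
theorem eLpNorm_cosh_smul_sq {τ : ℝ} (hτ : 0 < τ) {V : Type*} [NormedAddCommGroup V]
    [NormedSpace ℝ V] {ψ : Hyp τ → V} (hψ : Continuous (ψ ∘ (chart hτ).symm)) :
    eLpNorm (fun p : Hyp τ => Real.cosh (hypY τ p) • ψ p) 2 (hypWeighted hτ) ^ 2 =
      ∫⁻ x, ‖ψ ((chart hτ).symm x)‖ₑ ^ 2 := by
  have hψ' : Continuous ψ := by
    have := hψ.comp (chart hτ).continuous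
    rwa [Function.comp_assoc, Homeomorph.symm_comp_self, Function.comp_id] at this
  have hY : Continuous fun p : Hyp τ => hypY τ p.1 := by
    unfold hypY
    have (k : Fin 3) : Continuous fun p : Hyp τ => p.1 k :=
      (continuous_apply k).comp continuous_subtype_val
    exact Real.continuous_arsinh.comp
      (((((this 1).pow 2).add ((this 2).pow 2)).sqrt).div_const τ)
  have hc : Continuous fun p : Hyp τ => Real.cosh (hypY τ p) • ψ p :=
    (Real.continuous_cosh.comp hY).smul hψ'
  have h2 := eLpNorm_nnreal_pow_eq_lintegral (p := 2)
    (f := fun p : Hyp τ => Real.cosh (hypY τ p) • ψ p) (μ := hypWeighted hτ) two_ne_zero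
  simp only [ENNReal.coe_ofNat, NNReal.coe_ofNat, ENNReal.rpow_ofNat] at h2
  rw [h2, lintegral_hypWeighted hτ (by exact (hc.enorm.measurable.pow_const 2))]
  refine lintegral_congr fun x => ?_
  have hx := timeFn_pos hτ x
  rw [enorm_smul, cosh_hypY, mul_pow, ← mul_assoc, Real.enorm_eq_ofReal (by positivity),
    ← ENNReal.ofReal_pow (by positivity), ← ENNReal.ofReal_mul (by positivity),
    ← mul_pow, div_mul_div_cancel₀ hx.ne', div_self hτ.ne']
  simp

/-! ### Skew-adjointness, product rule and smoothness for the covariant fields -/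

section CovariantDerivative
variable {E : Type*} [NormedAddCommGroup E] [NormedSpace ℝ E]
  {G : Type*} [TopologicalSpace G] [ChartedSpace E G] [Group G]
  {V : Type*} [NormedAddCommGroup V] [InnerProductSpace ℂ V]

/-- The Lie algebra acts by skew-adjoint operators. -/
theorem inner_lieAct_add {ρ : G →* (V ≃ₗᵢ[ℂ] V)}
    (hρ : MDifferentiableAt 𝓘(ℝ, E) 𝓘(ℝ, V →L[ℂ] V) (repOp ρ) 1)
    (a : GroupLieAlgebra 𝓘(ℝ, E) G) (v w : V) :
    inner ℂ (lieAct E ρ a v) w + inner ℂ v (lieAct E ρ a w) = 0 := by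
  let Φ : (V →L[ℂ] V) → ℂ := fun L => inner ℂ (L v) (L w)
  let ev (v : V) : (V →L[ℂ] V) →L[ℝ] V := (ContinuousLinearMap.apply ℂ V v).restrictScalars ℝ
  have hΦ : HasFDerivAt Φ _ (repOp ρ 1) :=
    ((ev v).hasFDerivAt (x := repOp ρ 1)).inner ℂ ((ev w).hasFDerivAt (x := repOp ρ 1))
  have h1 := hΦ.hasMFDerivAt.comp (1 : G) hρ.hasMFDerivAt
  -- Unitarity makes `g ↦ ⟨ρ(g)v, ρ(g)w⟩` constant; its differential at the identity is computed in
  -- two ways.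
  have hconst : Φ ∘ repOp ρ = fun _ : G => inner ℂ v w := by
    funext g
    exact (ρ g).inner_map_map v w
  rw [hconst] at h1
  have h2 := hasMFDerivAt_unique h1 (hasMFDerivAt_const _ _)
  have h3 := congrArg (fun L => L a) h2
  have h1v (v : V) : repOp ρ 1 v = v := by simp [repOp]
  have h4 : inner ℂ (repOp ρ 1 v) (lieAct E ρ a w) + inner ℂ (lieAct E ρ a v) (repOp ρ 1 w)
    = (0 : ℂ) := h3
  rw [h1v, h1v] at h4
  linear_combination h4

variable {τ : ℝ} (hτ : 0 < τ) {ρ : G →* (V ≃ₗᵢ[ℂ] V)}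
  {A : Hyp τ → Spacetime →ₗ[ℝ] GroupLieAlgebra 𝓘(ℝ, E) G}

/-- In the chart, the boost `Z_{0j}` is `-t ∂_j`. -/
theorem spatial_lorentzField (j : Fin 2) (x : Fin 2 → ℝ) :
    spatial (lorentzField 0 j.succ ((chart hτ).symm x)) =
      (-timeFn τ x) • (Pi.single j 1 : Fin 2 → ℝ) := by
  have h : lower ((chart hτ).symm x).1 0 = -timeFn τ x := by
    simp [lower, eta, time_chart_symm]
  ext i
  simp only [lorentzField, h]
  fin_cases i <;> fin_cases j <;> simp [spatial]

/-- The product rule for the gauge covariant boosts. -/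
theorem fderiv_inner_eq_covZ (hρ : MDifferentiableAt 𝓘(ℝ, E) 𝓘(ℝ, V →L[ℂ] V) (repOp ρ) 1)
    {φ ψ : Hyp τ → V} (hφ : IsSmooth hτ φ) (hψ : IsSmooth hτ ψ) (j : Fin 2) (x : Fin 2 → ℝ) :
    fderiv ℝ (fun x => inner ℂ (φ ((chart hτ).symm x)) (ψ ((chart hτ).symm x)) :
        (Fin 2 → ℝ) → ℂ) x (Pi.single j 1) =
      -((inner ℂ (covZ (E := E) hτ ρ A (0, j.succ) φ ((chart hτ).symm x)) (ψ ((chart hτ).symm x)) +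
        inner ℂ (φ ((chart hτ).symm x)) (covZ (E := E) hτ ρ A (0, j.succ) ψ ((chart hτ).symm x))) /
          timeFn τ x) := by
  have hT := timeFn_pos hτ x
  have h1 : DifferentiableAt ℝ (φ ∘ (chart hτ).symm) x :=
    hφ.contDiffAt.differentiableAt (by simp)
  have h2 : DifferentiableAt ℝ (ψ ∘ (chart hτ).symm) x :=
    hψ.contDiffAt.differentiableAt (by simp)
  -- This is the cancellation of the two connection terms.
  have hs := inner_lieAct_add hρ (A ((chart hτ).symm x)
    (lorentzField 0 j.succ ((chart hτ).symm x))) (φ ((chart hτ).symm x)) (ψ ((chart hτ).symm x))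
  rw [show (fun x => inner ℂ (φ ((chart hτ).symm x)) (ψ ((chart hτ).symm x)) :
    (Fin 2 → ℝ) → ℂ) = fun x => inner ℂ ((φ ∘ (chart hτ).symm) x) ((ψ ∘ (chart hτ).symm) x)
      from rfl, fderiv_inner_apply ℂ h1 h2]
  simp only [covZ, covD, tangentDeriv, Homeomorph.apply_symm_apply, spatial_lorentzField,
    map_smul, inner_add_left, inner_add_right, ← Complex.coe_smul, inner_smul_left,
    inner_smul_right, map_neg, Complex.conj_ofReal, Complex.ofReal_neg, Function.comp_apply]
  have hT' : (timeFn τ x : ℂ) ≠ 0 := Complex.ofReal_ne_zero.2 hT.ne'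
  field_simp
  linear_combination hs

/-- The gauge covariant fields preserve smoothness. -/
theorem IsSmooth.covZ [FiniteDimensional ℝ E] (hA : IsSmoothForm hτ A) {φ : Hyp τ → V}
    (hφ : IsSmooth hτ φ) (i : Fin 3 × Fin 3) : IsSmooth hτ (covZ hτ ρ A i φ) := by
  unfold IsSmooth at hφ ⊢
  have hg : ContDiff ℝ ∞ (graphPt τ) := by
    refine contDiff_pi.2 fun k => ?_
    fin_cases k
    · exact contDiff_timeFn hτ
    · exact contDiff_apply ℝ ℝ (0 : Fin 2)
    · exact contDiff_apply ℝ ℝ (1 : Fin 2)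
  have hl (μ : Fin 3) : ContDiff ℝ ∞ fun x => lower (graphPt τ x) μ := by
    unfold lower eta
    have (k : Fin 3) : ContDiff ℝ ∞ fun x => graphPt τ x k := contDiff_pi.1 hg k
    fun_prop
  have hX : ContDiff ℝ ∞ fun x => lorentzField i.1 i.2 (graphPt τ x) :=
    ((hl _).smul contDiff_const).sub ((hl _).smul contDiff_const)
  let L : E →L[ℝ] (V →L[ℂ] V) := mfderiv 𝓘(ℝ, E) 𝓘(ℝ, V →L[ℂ] V) (repOp ρ) 1
  let ev : (V →L[ℂ] V) →L[ℝ] V →L[ℝ] V := ContinuousLinearMap.restrictScalarsL ℂ V V ℝ ℝ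
  have hAX : ContDiff ℝ ∞ (F := E) fun x => (A ((chart hτ).symm x)
      (lorentzField i.1 i.2 (graphPt τ x)) : E) := by
    -- Smoothness of `A` is assumed componentwise, so `A(Z)` is expanded in the coordinate basis.
    have : (fun x => (A ((chart hτ).symm x) (lorentzField i.1 i.2 (graphPt τ x)) : E)) =
        fun x => ∑ μ, lorentzField i.1 i.2 (graphPt τ x) μ •
          (A ((chart hτ).symm x) (Pi.single μ 1) : E) := by
      funext x
      exact (A ((chart hτ).symm x)).pi_apply_eq_sum_univ _ |>.trans
        (Finset.sum_congr rfl fun μ _ => by congr 2; ext k; simp [Pi.single_apply, eq_comm])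
    rw [this]
    exact ContDiff.sum fun μ _ => (contDiff_pi.1 hX μ).smul (hA μ)
  have h1 : ContDiff ℝ ∞ fun x => fderiv ℝ (φ ∘ (chart hτ).symm) x
      (spatial (lorentzField i.1 i.2 (graphPt τ x))) :=
    (hφ.fderiv_right (by simp)).clm_apply (spatial.contDiff.comp hX)
  have h2 : ContDiff ℝ ∞ fun x => ev (L (A ((chart hτ).symm x)
      (lorentzField i.1 i.2 (graphPt τ x)))) ((φ ∘ (chart hτ).symm) x) :=
    (ev.contDiff.comp (L.contDiff.comp hAX)).clm_apply hφ
  refine Eq.mp (congrArg (ContDiff ℝ ∞) (funext fun x => ?_)) (h1.add h2)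
  simp only [Function.comp_apply, GaugeHyp.covZ, covD, tangentDeriv,
    Homeomorph.apply_symm_apply]
  rfl

end CovariantDerivative

/-! ### Partial derivatives along the coordinate lines -/

theorem hasDerivAt_comp_fst {F : Type*} [NormedAddCommGroup F] [NormedSpace ℝ F]
    {u : (Fin 2 → ℝ) → F} (hu : Differentiable ℝ u) (x y : ℝ) :
    HasDerivAt (fun s => u ![s, y]) (fderiv ℝ u ![x, y] (Pi.single 0 1)) x := by
  have h : HasDerivAt (fun s : ℝ => ![s, y]) (Pi.single 0 1 : Fin 2 → ℝ) x := by
    refine hasDerivAt_pi.2 fun i => ?_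
    fin_cases i
    · simpa using hasDerivAt_id' x
    · simpa using hasDerivAt_const x y
  exact (hu ![x, y]).hasFDerivAt.comp_hasDerivAt x h

theorem hasDerivAt_comp_snd {F : Type*} [NormedAddCommGroup F] [NormedSpace ℝ F]
    {u : (Fin 2 → ℝ) → F} (hu : Differentiable ℝ u) (x y : ℝ) :
    HasDerivAt (fun s => u ![x, s]) (fderiv ℝ u ![x, y] (Pi.single 1 1)) y := by
  have h : HasDerivAt (fun s : ℝ => ![x, s]) (Pi.single 1 1 : Fin 2 → ℝ) y := by
    refine hasDerivAt_pi.2 fun i => ?_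
    fin_cases i
    · simpa using hasDerivAt_const y x
    · simpa using hasDerivAt_id' y
  exact (hu ![x, y]).hasFDerivAt.comp_hasDerivAt y h

theorem hasDerivAt_timeFn {τ : ℝ} (hτ : 0 < τ) (x y : ℝ) :
    HasDerivAt (fun s => timeFn τ ![s, y]) (x / timeFn τ ![x, y]) x := by
  have h : HasDerivAt (fun s : ℝ => τ ^ 2 + s ^ 2 + y ^ 2) (2 * x) x := by
    simpa using (((hasDerivAt_id x).pow 2).const_add (τ ^ 2)).add_const (y ^ 2)
  refine (h.sqrt (by positivity)).congr_deriv ?_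
  simp only [timeFn, Matrix.cons_val_zero, Matrix.cons_val_one]
  rw [mul_div_mul_left _ _ two_ne_zero]

/-! ### The covariant Klainerman–Sobolev estimate -/

section Sobolev

variable {V : Type*} [NormedAddCommGroup V] [InnerProductSpace ℂ V]

/-- Pointwise bound for the integrand of the Sobolev inequality applied to `|v|²`, in terms of
`v` and its derivatives `v₁, v₂, v₁₂` by the scaled fields. -/
theorem sobolev_integrand_le (v v₁ v₂ v₁₂ : V) {T h s : ℝ} (hT : 0 < T) (hh : 0 ≤ h)
    (hhT : h ≤ T / 2) (hs : |s| ≤ T) :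
    ‖inner ℂ v v‖ + h * ‖-((inner ℂ v₁ v + inner ℂ v v₁) / (T : ℂ))‖ +
        h * ‖-((inner ℂ v₂ v + inner ℂ v v₂) / (T : ℂ))‖ +
        h ^ 2 * ‖((inner ℂ v₁₂ v + inner ℂ v₂ v₁) + (inner ℂ v₁ v₂ + inner ℂ v v₁₂)) / (T : ℂ) ^ 2 +
          (inner ℂ v₂ v + inner ℂ v v₂) * (s : ℂ) / (T : ℂ) ^ 3‖ ≤
      3 * (‖v‖ ^ 2 + ‖v₁‖ ^ 2 + ‖v₂‖ ^ 2 + ‖v₁₂‖ ^ 2) := by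
  have hi (v w : V) : ‖(inner ℂ v w : ℂ)‖ ≤ ‖v‖ * ‖w‖ := norm_inner_le_norm v w
  have hr : h / T ≤ 1 / 2 := by rw [div_le_iff₀ hT]; linarith
  have hr0 : 0 ≤ h / T := by positivity
  have hr2 : (h / T) ^ 2 ≤ 1 / 4 := by nlinarith
  have hsT : |s| / T ≤ 1 := (div_le_one hT).2 hs
  have hw (w : V) : ‖(inner ℂ w v + inner ℂ v w : ℂ)‖ ≤ 2 * (‖v‖ * ‖w‖) :=
    (norm_add_le _ _).trans (by linarith [hi w v, hi v w, mul_comm ‖v‖ ‖w‖])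
  have h1 (w : V) : h * ‖-((inner ℂ w v + inner ℂ v w) / (T : ℂ))‖ ≤ ‖v‖ * ‖w‖ := by
    rw [norm_neg, norm_div, Complex.norm_real, Real.norm_of_nonneg hT.le, mul_div_left_comm]
    calc _ ≤ 2 * (‖v‖ * ‖w‖) * (1 / 2) := mul_le_mul (hw w) hr hr0 (by positivity)
      _ = _ := by ring
  have h3 : ‖((inner ℂ v₁₂ v + inner ℂ v₂ v₁) + (inner ℂ v₁ v₂ + inner ℂ v v₁₂) : ℂ)‖ ≤
      2 * (‖v‖ * ‖v₁₂‖) + 2 * (‖v₁‖ * ‖v₂‖) := by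
    refine (norm_add_le _ _).trans ((add_le_add (norm_add_le _ _) (norm_add_le _ _)).trans ?_)
    linarith [hi v₁₂ v, hi v₂ v₁, hi v₁ v₂, hi v v₁₂, mul_comm ‖v‖ ‖v₁₂‖, mul_comm ‖v₁‖ ‖v₂‖]
  have h4 : h ^ 2 * ‖((inner ℂ v₁₂ v + inner ℂ v₂ v₁) + (inner ℂ v₁ v₂ + inner ℂ v v₁₂)) /
      (T : ℂ) ^ 2 + (inner ℂ v₂ v + inner ℂ v v₂) * (s : ℂ) / (T : ℂ) ^ 3‖ ≤
      1 / 4 * (2 * (‖v‖ * ‖v₁₂‖) + 2 * (‖v₁‖ * ‖v₂‖) + 2 * (‖v‖ * ‖v₂‖)) := by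
    set P : ℂ := (inner ℂ v₁₂ v + inner ℂ v₂ v₁) + (inner ℂ v₁ v₂ + inner ℂ v v₁₂)
    set W : ℂ := inner ℂ v₂ v + inner ℂ v v₂
    calc _ ≤ h ^ 2 * (‖P / (T : ℂ) ^ 2‖ + ‖W * (s : ℂ) / (T : ℂ) ^ 3‖) := by
          gcongr
          exact norm_add_le _ _
      _ = (h / T) ^ 2 * (‖P‖ + ‖W‖ * (|s| / T)) := by
          simp only [norm_div, norm_mul, norm_pow, Complex.norm_real, Real.norm_eq_abs,
            abs_of_pos hT]
          field_simp
      _ ≤ (1 / 4) * (‖P‖ + ‖W‖ * 1) := by gcongr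
      _ ≤ _ := by linarith [h3, hw v₂]
  have h0 : ‖(inner ℂ v v : ℂ)‖ ≤ ‖v‖ ^ 2 := (hi v v).trans_eq (sq _).symm
  -- Each product is split by `2ab ≤ a² + b²`; the largest resulting coefficient, that of `‖v‖²`, is
  -- `5/2`.
  nlinarith [h1 v₁, h1 v₂, sq_nonneg (‖v‖ - ‖v₁‖), sq_nonneg (‖v‖ - ‖v₂‖),
    sq_nonneg (‖v‖ - ‖v₁₂‖), sq_nonneg (‖v₁‖ - ‖v₂‖), sq_nonneg ‖v₁‖, sq_nonneg ‖v₂‖,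
    sq_nonneg ‖v₁₂‖, sq_nonneg ‖v‖]

variable {E : Type*} [NormedAddCommGroup E] [NormedSpace ℝ E] [FiniteDimensional ℝ E]
  {G : Type*} [TopologicalSpace G] [ChartedSpace E G] [Group G]
  {τ : ℝ} (hτ : 0 < τ) {ρ : G →* (V ≃ₗᵢ[ℂ] V)}
  {A : Hyp τ → Spacetime →ₗ[ℝ] GroupLieAlgebra 𝓘(ℝ, E) G}

/-- The gauge covariant Klainerman–Sobolev inequality in the chart, in squared form. -/
theorem timeFn_sq_mul_enorm_sq_le
    (hρ : MDifferentiableAt 𝓘(ℝ, E) 𝓘(ℝ, V →L[ℂ] V) (repOp ρ) 1)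
    (hA : IsSmoothForm hτ A) {φ : Hyp τ → V} (hφ : IsSmooth hτ φ) (a : Fin 2 → ℝ) :
    ENNReal.ofReal (timeFn τ a) ^ 2 * ‖φ ((chart hτ).symm a)‖ₑ ^ 2 ≤
      48 * ∫⁻ x, (‖φ ((chart hτ).symm x)‖ₑ ^ 2 +
        ‖covZ hτ ρ A (0, 1) φ ((chart hτ).symm x)‖ₑ ^ 2 +
        ‖covZ hτ ρ A (0, 2) φ ((chart hτ).symm x)‖ₑ ^ 2 +
        ‖covZ hτ ρ A (0, 1) (covZ hτ ρ A (0, 2) φ) ((chart hτ).symm x)‖ₑ ^ 2) := by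
  set φ₁ := covZ hτ ρ A (0, 1) φ with hφ₁
  set φ₂ := covZ hτ ρ A (0, 2) φ with hφ₂
  set φ₁₂ := covZ hτ ρ A (0, 1) φ₂ with hφ₁₂
  have hs₁ : IsSmooth hτ φ₁ := hφ.covZ hτ hA _
  have hs₂ : IsSmooth hτ φ₂ := hφ.covZ hτ hA _
  have hs₁₂ : IsSmooth hτ φ₁₂ := hs₂.covZ hτ hA _
  let P (ψ χ : Hyp τ → V) (x : Fin 2 → ℝ) : ℂ :=
    inner ℂ (ψ ((chart hτ).symm x)) (χ ((chart hτ).symm x))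
  have hP {ψ χ : Hyp τ → V} (hψ : IsSmooth hτ ψ) (hχ : IsSmooth hτ χ) : ContDiff ℝ ∞ (P ψ χ) :=
    ContDiff.inner ℂ hψ hχ
  have hPd {ψ χ : Hyp τ → V} (hψ : IsSmooth hτ ψ) (hχ : IsSmooth hτ χ) :
      Differentiable ℝ (P ψ χ) := (hP hψ hχ).differentiable (by simp)
  have hPc {ψ χ : Hyp τ → V} (hψ : IsSmooth hτ ψ) (hχ : IsSmooth hτ χ) :
      Continuous (P ψ χ) := (hP hψ hχ).continuous
  have hd₁ {ψ χ : Hyp τ → V} (hψ : IsSmooth hτ ψ) (hχ : IsSmooth hτ χ) (x y : ℝ) :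
      HasDerivAt (fun s => P ψ χ ![s, y]) (-((P (covZ hτ ρ A (0, 1) ψ) χ ![x, y] +
        P ψ (covZ hτ ρ A (0, 1) χ) ![x, y]) / timeFn τ ![x, y])) x :=
    (hasDerivAt_comp_fst (hPd hψ hχ) x y).congr_deriv
      (fderiv_inner_eq_covZ hτ hρ hψ hχ 0 ![x, y])
  have hd₂ (x y : ℝ) : HasDerivAt (fun s => P φ φ ![x, s])
      (-((P φ₂ φ ![x, y] + P φ φ₂ ![x, y]) / timeFn τ ![x, y])) y :=
    (hasDerivAt_comp_snd (hPd hφ hφ) x y).congr_deriv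
      (fderiv_inner_eq_covZ hτ hρ hφ hφ 1 ![x, y])
  have hT (x : Fin 2 → ℝ) : (timeFn τ x : ℂ) ≠ 0 :=
    Complex.ofReal_ne_zero.2 (timeFn_pos hτ x).ne'
  -- The term with `t³` comes from differentiating the factor `1/t` of the first boost.
  have hd₁₂ (x y : ℝ) : HasDerivAt
      (fun s => -((P φ₂ φ ![s, y] + P φ φ₂ ![s, y]) / (timeFn τ ![s, y] : ℂ)))
      (((P φ₁₂ φ ![x, y] + P φ₂ φ₁ ![x, y]) + (P φ₁ φ₂ ![x, y] + P φ φ₁₂ ![x, y])) /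
        (timeFn τ ![x, y] : ℂ) ^ 2 +
        (P φ₂ φ ![x, y] + P φ φ₂ ![x, y]) * (x : ℂ) / (timeFn τ ![x, y] : ℂ) ^ 3) x := by
    refine ((((hd₁ hs₂ hφ x y).add (hd₁ hφ hs₂ x y)).div
      (hasDerivAt_timeFn hτ x y).ofReal_comp (hT _)).neg).congr_deriv ?_
    have := hT ![x, y]
    simp only [← hφ₁, ← hφ₁₂, Complex.ofReal_div, Pi.add_apply]
    field_simp
    ring
  have hTc : Continuous fun x => (timeFn τ x : ℂ) :=
    Complex.continuous_ofReal.comp (contDiff_timeFn hτ).continuous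
  have he : Continuous fun p : ℝ × ℝ => ![p.1, p.2] := by fun_prop
  have hTa := timeFn_pos hτ a
  have hc₁ {ψ : Hyp τ → V} (hψ : IsSmooth hτ ψ) :
      Continuous fun x => -((P ψ φ x + P φ ψ x) / (timeFn τ x : ℂ)) :=
    (((hPc hψ hφ).add (hPc hφ hψ)).div hTc hT).neg
  have hc₁₂ : Continuous fun x =>
      ((P φ₁₂ φ x + P φ₂ φ₁ x) + (P φ₁ φ₂ x + P φ φ₁₂ x)) / (timeFn τ x : ℂ) ^ 2 +
        (P φ₂ φ x + P φ φ₂ x) * (x 0 : ℂ) / (timeFn τ x : ℂ) ^ 3 :=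
    ((((hPc hs₁₂ hφ).add (hPc hs₂ hs₁)).add ((hPc hs₁ hs₂).add (hPc hφ hs₁₂))).div
      (hTc.pow 2) fun x => pow_ne_zero _ (hT x)).add
      ((((hPc hs₂ hφ).add (hPc hφ hs₂)).mul
        (Complex.continuous_ofReal.comp (continuous_apply 0))).div
        (hTc.pow 3) fun x => pow_ne_zero _ (hT x))
  have main := enorm_corner_le_lintegral (u := fun p : ℝ × ℝ => P φ φ ![p.1, p.2])
    (u₁ := fun p => -((P φ₁ φ ![p.1, p.2] + P φ φ₁ ![p.1, p.2]) / (timeFn τ ![p.1, p.2] : ℂ)))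
    (hd₁ hφ hφ) hd₂ hd₁₂ ((hPc hφ hφ).comp he) ((hc₁ hs₁).comp he) ((hc₁ hs₂).comp he)
    (hc₁₂.comp he) (a 0, a 1) (timeFn τ a / 4)
  have ha : ![a 0, a 1] = a := by ext i; fin_cases i <;> rfl
  let F (x : Fin 2 → ℝ) : ℝ≥0∞ := 3 * (‖φ ((chart hτ).symm x)‖ₑ ^ 2 +
    ‖φ₁ ((chart hτ).symm x)‖ₑ ^ 2 + ‖φ₂ ((chart hτ).symm x)‖ₑ ^ 2 +
    ‖φ₁₂ ((chart hτ).symm x)‖ₑ ^ 2)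
  have hF : ∫⁻ p : ℝ × ℝ, F ![p.1, p.2] = ∫⁻ x, F x :=
    (volume_preserving_finTwoArrow ℝ).symm.lintegral_comp_emb
      (MeasurableEquiv.finTwoArrow.symm.measurableEmbedding) F
  -- The pointwise bound is needed only on the square; afterwards the integral is enlarged to the
  -- whole plane.
  have main' := main.trans ((setLIntegral_mono_ae' (g := fun p => F ![p.1, p.2])
    (measurableSet_Ioc.prod measurableSet_Ioc)
    (Filter.Eventually.of_forall fun p hp => ?_)).trans (setLIntegral_le_lintegral _ _))
  · rw [hF, lintegral_const_mul' _ _ (by simp), ha] at main'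
    have hu : ‖P φ φ a‖ₑ = ‖φ ((chart hτ).symm a)‖ₑ ^ 2 := by
      simp only [P, inner_self_eq_norm_sq_to_K, enorm_pow]
      rw [← ofReal_norm, RCLike.norm_ofReal, abs_norm, ofReal_norm]
    rw [hu] at main'
    -- The side `t(a)/4` costs a factor `16`, and the integrand bound a factor `3`, giving `48`.
    have h16 : ENNReal.ofReal (timeFn τ a) ^ 2 =
        16 * ENNReal.ofReal (timeFn τ a / 4) ^ 2 := by
      rw [← ENNReal.ofReal_pow hTa.le, ← ENNReal.ofReal_pow (by positivity),
        show (16 : ℝ≥0∞) = ENNReal.ofReal 16 by simp, ← ENNReal.ofReal_mul (by norm_num)]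
      congr 1
      ring
    rw [h16, mul_assoc, show (48 : ℝ≥0∞) = 16 * 3 by norm_num, mul_assoc]
    gcongr
  · have hpt : timeFn τ a / 2 ≤ timeFn τ ![p.1, p.2] := by
      refine timeFn_half_le hτ fun i => ?_
      obtain ⟨⟨h1, h2⟩, h3, h4⟩ := hp
      simp only at h1 h2 h3 h4
      fin_cases i
      · exact abs_le.2 ⟨by simp; linarith, by simp; linarith⟩
      · exact abs_le.2 ⟨by simp; linarith, by simp; linarith⟩
    have hb := sobolev_integrand_le (φ ((chart hτ).symm ![p.1, p.2]))
      (φ₁ ((chart hτ).symm ![p.1, p.2])) (φ₂ ((chart hτ).symm ![p.1, p.2]))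
      (φ₁₂ ((chart hτ).symm ![p.1, p.2])) (timeFn_pos hτ ![p.1, p.2])
      (h := timeFn τ a / 4) (by positivity) (by linarith) (abs_le_timeFn τ ![p.1, p.2])
    have hb' := ENNReal.ofReal_le_ofReal hb
    have h4 : 0 ≤ timeFn τ a / 4 := by positivity
    rw [ENNReal.ofReal_add (by positivity) (by positivity),
      ENNReal.ofReal_add (by positivity) (by positivity),
      ENNReal.ofReal_add (by positivity) (by positivity), ENNReal.ofReal_mul h4,
      ENNReal.ofReal_mul h4, ENNReal.ofReal_mul (by positivity), ENNReal.ofReal_pow h4,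
      ENNReal.ofReal_mul (by norm_num), ENNReal.ofReal_add (by positivity) (by positivity),
      ENNReal.ofReal_add (by positivity) (by positivity),
      ENNReal.ofReal_add (by positivity) (by positivity),
      ENNReal.ofReal_pow (norm_nonneg _), ENNReal.ofReal_pow (norm_nonneg _),
      ENNReal.ofReal_pow (norm_nonneg _), ENNReal.ofReal_pow (norm_nonneg _),
      ENNReal.ofReal_ofNat] at hb'
    simp only [ofReal_norm] at hb'
    exact hb'

/-- The gauge covariant Klainerman–Sobolev inequality on `H_τ`, pointwise. -/
theorem enorm_smul_cosh_smul_le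
    (hρ : MDifferentiableAt 𝓘(ℝ, E) 𝓘(ℝ, V →L[ℂ] V) (repOp ρ) 1)
    (hA : IsSmoothForm hτ A) {φ : Hyp τ → V} (hφ : IsSmooth hτ φ) (p : Hyp τ) :
    ‖τ • Real.cosh (hypY τ p) • φ p‖ₑ ≤ 14 * ∑ k ∈ Finset.range 3, normZ hτ ρ A k φ := by
  set S := ∑ k ∈ Finset.range 3, normZ hτ ρ A k φ
  have hS (k : ℕ) (hk : k < 3) (I : Fin k → Fin 3 × Fin 3) :
      eLpNorm (fun p : Hyp τ => Real.cosh (hypY τ p) • covZs hτ ρ A (List.ofFn I) φ p) 2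
        (hypWeighted hτ) ≤ S :=
    (Finset.single_le_sum (f := fun I : Fin k → Fin 3 × Fin 3 =>
      eLpNorm (fun p : Hyp τ => Real.cosh (hypY τ p) • covZs hτ ρ A (List.ofFn I) φ p) 2
        (hypWeighted hτ)) (fun _ _ => zero_le) (Finset.mem_univ I)).trans
      (Finset.single_le_sum (f := fun k => normZ hτ ρ A k φ) (fun _ _ => zero_le)
        (Finset.mem_range.2 hk))
  have hI {ψ : Hyp τ → V} (hψ : IsSmooth hτ ψ)
      (h : eLpNorm (fun p : Hyp τ => Real.cosh (hypY τ p) • ψ p) 2 (hypWeighted hτ) ≤ S) :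
      ∫⁻ x, ‖ψ ((chart hτ).symm x)‖ₑ ^ 2 ≤ S ^ 2 := by
    rw [← eLpNorm_cosh_smul_sq hτ hψ.continuous]
    gcongr
  have hm {ψ : Hyp τ → V} (hψ : IsSmooth hτ ψ) :
      Measurable fun x => ‖ψ ((chart hτ).symm x)‖ₑ ^ 2 :=
    hψ.continuous.enorm.measurable.pow_const 2
  have h₁ : IsSmooth hτ (covZ hτ ρ A (0, 1) φ) := hφ.covZ hτ hA _
  have h₂ : IsSmooth hτ (covZ hτ ρ A (0, 2) φ) := hφ.covZ hτ hA _
  have h₁₂ : IsSmooth hτ (covZ hτ ρ A (0, 1) (covZ hτ ρ A (0, 2) φ)) := h₂.covZ hτ hA _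
  have i₀ := hI hφ (by simpa [covZs] using hS 0 (by norm_num) ![])
  have i₁ := hI h₁ (by simpa [covZs] using hS 1 (by norm_num) ![(0, 1)])
  have i₂ := hI h₂ (by simpa [covZs] using hS 1 (by norm_num) ![(0, 2)])
  -- The head of the list acts last, so this is `𝐙₀₁𝐙₀₂φ`.
  have i₁₂ := hI h₁₂ (by simpa [covZs] using hS 2 (by norm_num) ![(0, 1), (0, 2)])
  have key := timeFn_sq_mul_enorm_sq_le hτ hρ hA hφ (chart hτ p)
  rw [lintegral_add_right _ (hm h₁₂), lintegral_add_right _ (hm h₂),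
    lintegral_add_right _ (hm h₁)] at key
  have hcosh := cosh_hypY hτ (chart hτ p)
  rw [Homeomorph.symm_apply_apply] at key hcosh
  have hT := timeFn_pos hτ (chart hτ p)
  rw [smul_smul, hcosh, mul_div_cancel₀ _ hτ.ne', enorm_smul,
    Real.enorm_eq_ofReal hT.le, ← ENNReal.pow_le_pow_left_iff two_ne_zero, mul_pow]
  -- Four integrals, each at most `S²`, give `192`; the next perfect square is `196 = 14²`.
  calc _ ≤ 48 * (S ^ 2 + S ^ 2 + S ^ 2 + S ^ 2) := key.trans (by gcongr)
    _ = 192 * S ^ 2 := by ring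
    _ ≤ 196 * S ^ 2 := by gcongr; norm_num
    _ = (14 * S) ^ 2 := by ring

end Sobolev

end GaugeHyp

end

theorem mainTheorem4 :
    ∃ C : ℝ, 0 < C ∧
      ∀ (E : Type*) [NormedAddCommGroup E] [NormedSpace ℝ E] [FiniteDimensional ℝ E]
        (G : Type*) [TopologicalSpace G] [ChartedSpace E G] [Group G] [LieGroup 𝓘(ℝ, E) ∞ G]
        (V : Type*) [NormedAddCommGroup V] [InnerProductSpace ℂ V] [FiniteDimensional ℂ V]
        (ρ : G →* (V ≃ₗᵢ[ℂ] V))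
        (_hρ : ContMDiff 𝓘(ℝ, E) 𝓘(ℝ, V →L[ℂ] V) ∞ (GaugeHyp.repOp ρ))
        (τ : ℝ) (hτ : 0 < τ)
        (A : GaugeHyp.Hyp τ → GaugeHyp.Spacetime →ₗ[ℝ] GroupLieAlgebra 𝓘(ℝ, E) G)
        (_hA : GaugeHyp.IsSmoothForm hτ A)
        (φ : GaugeHyp.Hyp τ → V) (_hφ : GaugeHyp.IsSmooth hτ φ),
        ENNReal.ofReal τ *
            eLpNorm (fun p : GaugeHyp.Hyp τ => Real.cosh (GaugeHyp.hypY τ p) • φ p) ∞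
              (GaugeHyp.hypWeighted hτ)
          ≤ ENNReal.ofReal C * ∑ k ∈ Finset.range 3, GaugeHyp.normZ hτ ρ A k φ := by
  refine ⟨14, by norm_num, ?_⟩
  intro E _ _ _ G _ _ _ _ V _ _ _ ρ hρ τ hτ A hA φ hφ
  have h1 : MDifferentiableAt 𝓘(ℝ, E) 𝓘(ℝ, V →L[ℂ] V) (GaugeHyp.repOp ρ) 1 :=
    (hρ 1).mdifferentiableAt (by simp)
  rw [← Real.enorm_eq_ofReal hτ.le, ← eLpNorm_const_smul, eLpNorm_exponent_top,
    ENNReal.ofReal_ofNat]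
  -- The bound holds at every point, so it bounds the essential supremum.
  exact essSup_le_of_ae_le _
    (Filter.Eventually.of_forall (GaugeHyp.enorm_smul_cosh_smul_le hτ h1 hA hφ))
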